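/- Let $K$ be a non-archimedean local field with residue field of cardinality $q$, let $K^s$ be a separable closure of $K$, and let $G_K=\mathrm{Gal}(K^s/K)$ with inertia subgroup $I_K$, the subgroup of elements acting trivially on the residue field $k_s$ of $K^s$. Let $W_K\subset G_K$ be the Weil group, consisting of the elements which act on $k_s$ as an integral power of the Frobenius automorphism $x\mapsto x^q$, with the group topology in which $I_K$ is open and carries its Krull topology. A Weil representation over $K$ is a finite-dimensional complex representation $\rho$ of $W_K$ which is continuous for the usual topology of $\mathbb C$. For a finite separable extension $L$ of $K$ in $K^s$ let $I_L=I_K\cap \mathrm{Gal}(K^s/L)$; we say that $\rho$ is unramified over $L$ if $\rho(I_L)=1$. Let $\mathrm{Frob}_L\in \mathrm{Gal}(K^s/L)$ denote any arithmetic Frobenius element, that is, an element acting on $k_s$ as $x\mapsto x^{q_L}$, where $q_L$ is the cardinality of the residue field of $L$ (such an element lies in $W_K$, and $\mathrm{tr}\,\rho(\mathrm{Frob}_L)$ does not depend on its choice if $\rho$ is unramified over $L$). Then every semisimple Weil representation over $K$ is uniquely determined by its traces $\mathrm{tr}\,\rho(\mathrm{Frob}_L)$ over the finite separable extensions $L$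 of $K$ over which it is unramified. Precisely: let $\rho_1$ and $\rho_2$ be semisimple Weil representations over $K$ such that $$\mathrm{tr}\,\rho_1(\mathrm{Frob}_L)=\mathrm{tr}\,\rho_2(\mathrm{Frob}_L)$$ for every finite separable extension $L\subset K^s$ of $K$ over which both $\rho_1$ and $\rho_2$ are unramified. Then $\rho_1\cong\rho_2$. -/

import Mathlib

open scoped ValuativeRel

namespace LocalWeil


/-- For an algebraic extension `L` of a local field `K`, the integral closure of `𝒪[K]` in `L`
(the ring of integers of `L`) is a local ring. -/
instance isLocalRing_integralClosure (K : Type*) [Field K] [ValuativeRel K] [TopologicalSpace K]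
    [IsNonarchimedeanLocalField K] (L : Type*) [Field L] [Algebra K L]
    [Algebra.IsAlgebraic K L] :
    IsLocalRing (integralClosure 𝒪[K] L) := by
  let := IsTopologicalAddGroup.rightUniformSpace K
  have := isUniformAddGroup_of_addCommGroup (G := K)
  let : (Valued.v (R := K)).RankOne :=
  { hom' := ValuativeRel.IsRankLeOne.nonempty.some.emb (R := K).comp
      MonoidWithZeroHom.ValueGroup₀.embedding
    strictMono' := ValuativeRel.IsRankLeOne.nonempty.some.strictMono.comp
        MonoidWithZeroHom.ValueGroup₀.embedding_strictMono }
  let : NontriviallyNormedField K :=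
    Valued.toNontriviallyNormedField K (ValuativeRel.ValueGroupWithZero K)
  have : IsUltrametricDist K := inferInstance
  have : CompleteSpace K := inferInstance
  have hnorm : ∀ a : K, ‖a‖ ≤ 1 ↔ a ∈ 𝒪[K] := fun a =>
    Valued.toNormedField.norm_le_one_iff
  have hint : ∀ x : L, IsIntegral 𝒪[K] x ↔ spectralNorm K L x ≤ 1 := by
    intro x
    have hm := minpoly.monic (Algebra.IsAlgebraic.isAlgebraic (R := K) x).isIntegral
    rw [spectralNorm, spectralValue_le_one_iff hm]
    constructor
    · intro hx n
      have h := minpoly.isIntegrallyClosed_eq_field_fractions (S := L) K L hx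
      rw [Algebra.algebraMap_self, RingHom.id_apply] at h
      rw [h, Polynomial.coeff_map, hnorm]
      exact ((minpoly 𝒪[K] x).coeff n).2
    · intro h
      obtain ⟨p, hp, -, hpm⟩ := Polynomial.lifts_and_degree_eq_and_monic
        ((Polynomial.lifts_iff_coeff_lifts (f := algebraMap 𝒪[K] K) _).2
          fun n => ⟨⟨_, (hnorm _).1 (h n)⟩, rfl⟩) hm
      refine ⟨p, hpm, ?_⟩
      have hp' : p.map (algebraMap 𝒪[K] K) = minpoly K x := hp
      have hx := minpoly.aeval K x
      rw [← hp', Polynomial.aeval_map_algebraMap] at hx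
      exact hx
  refine IsLocalRing.of_isUnit_or_isUnit_of_isUnit_add fun a b hab => ?_
  have hmul : ∀ x y : L, spectralNorm K L (x * y) = spectralNorm K L x * spectralNorm K L y :=
    fun x y => spectralAlgNorm_mul x y
  have hone : spectralNorm K L 1 = 1 := spectralNorm_one
  have hunit : ∀ c : integralClosure 𝒪[K] L, IsUnit c ↔ spectralNorm K L c = 1 := by
    intro c
    have hc : spectralNorm K L c ≤ 1 := (hint _).1 c.2
    constructor
    · rintro hu
      obtain ⟨d, hd⟩ := hu.exists_right_inv
      have hd' : (c : L) * d = 1 := by exact_mod_cast congrArg Subtype.val hd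
      have h1 : spectralNorm K L c * spectralNorm K L d = 1 := by rw [← hmul, hd', hone]
      have h2 : spectralNorm K L d ≤ 1 := (hint _).1 d.2
      nlinarith [spectralNorm_nonneg (K := K) (c : L)]
    · intro h
      have h0 : (c : L) ≠ 0 := by
        intro h0
        rw [h0, spectralNorm_zero] at h
        exact zero_ne_one h
      have h1 := hmul (c : L) (c : L)⁻¹
      rw [mul_inv_cancel₀ h0, hone, h, one_mul] at h1
      exact IsUnit.of_mul_eq_one ⟨(c : L)⁻¹, (hint _).2 h1.ge⟩
        (Subtype.ext (mul_inv_cancel₀ h0))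
  rw [hunit] at hab
  have hadd := isNonarchimedean_spectralNorm (K := K) (L := L) (a : L) (b : L)
  have ha : spectralNorm K L a ≤ 1 := (hint _).1 a.2
  have hb : spectralNorm K L b ≤ 1 := (hint _).1 b.2
  have hab' : (1 : ℝ) ≤ max (spectralNorm K L a) (spectralNorm K L b) := by
    rw [← hab]; exact hadd
  rw [hunit, hunit]
  rcases le_max_iff.1 hab' with h | h
  · exact .inl (le_antisymm ha h)
  · exact .inr (le_antisymm hb h)

section Residue

variable (K : Type*) [Field K] [ValuativeRel K] [TopologicalSpace K]
  [IsNonarchimedeanLocalField K] (L : Type*) [Field L] [Algebra K L] [Algebra.IsAlgebraic K L]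

instance isLocalHom_integralClosure :
    IsLocalHom (algebraMap 𝒪[K] (integralClosure 𝒪[K] L)) :=
  RingHom.IsIntegral.isLocalHom (algebraMap_isIntegral_iff.2 inferInstance) fun _ _ hab =>
    Subtype.ext ((algebraMap K L).injective (congrArg Subtype.val hab))

/-- The residue field of the ring of integers of an algebraic extension `L` of `K`. -/
abbrev ResField : Type _ := IsLocalRing.ResidueField (integralClosure 𝒪[K] L)

instance isAlgebraic_resField : Algebra.IsAlgebraic 𝓀[K] (ResField K L) := by
  refine ⟨fun x => ?_⟩
  obtain ⟨y, rfl⟩ := IsLocalRing.residue_surjective x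
  obtain ⟨p, hp, h⟩ := Algebra.IsIntegral.isIntegral (R := 𝒪[K]) y
  refine IsIntegral.isAlgebraic ⟨p.map (IsLocalRing.residue 𝒪[K]), hp.map _, ?_⟩
  have := congrArg (IsLocalRing.residue (integralClosure 𝒪[K] L)) h
  rw [Polynomial.hom_eval₂, map_zero] at this
  rw [Polynomial.eval₂_map]
  exact this

/-- The Frobenius automorphism `x ↦ x ^ q` of the residue field of `L`, where `q` is the number of
elements of the residue field of `K`. -/
noncomputable def residueFrobenius : RingAut (ResField K L) :=
  letI : Fintype 𝓀[K] := Fintype.ofFinite _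
  (FiniteField.frobeniusAlgEquivOfAlgebraic 𝓀[K] (ResField K L)).toRingEquiv

theorem residueFrobenius_apply (x : ResField K L) :
    residueFrobenius K L x = x ^ Nat.card 𝓀[K] := by
  let : Fintype 𝓀[K] := Fintype.ofFinite _
  rw [Nat.card_eq_fintype_card]
  rfl

/-- The action of `Gal(L/K)` on the residue field of `L`. -/
noncomputable def residueAction : Gal(L/K) →* RingAut (ResField K L) :=
  MulSemiringAction.toRingAut Gal(L/K) (ResField K L)

end Residue

section Weil

variable (K : Type*) [Field K] [ValuativeRel K] [TopologicalSpace K]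
  [IsNonarchimedeanLocalField K] (Ks : Type*) [Field Ks] [Algebra K Ks] [IsSepClosure K Ks]

/-- The absolute inertia group `I_K`: the automorphisms of the separable closure `Ks` over `K` that
act trivially on the residue field of `Ks`. -/
noncomputable def inertiaGroup : Subgroup Gal(Ks/K) := (residueAction K Ks).ker

/-- The Weil group as a subgroup of the absolute Galois group: the automorphisms that act on the
residue field of `Ks` as an integral power of Frobenius. -/
noncomputable def weilSubgroup : Subgroup Gal(Ks/K) :=
  (Subgroup.zpowers (residueFrobenius K Ks)).comap (residueAction K Ks)

/-- The Weil group of `K`. It is a type of its own since its topology is not the subspace topology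
of the absolute Galois group. -/
def WeilGroup : Type _ := weilSubgroup K Ks

namespace WeilGroup

noncomputable instance : Group (WeilGroup K Ks) := inferInstanceAs (Group (weilSubgroup K Ks))

/-- The inclusion of the Weil group in the absolute Galois group. -/
noncomputable def toGal : WeilGroup K Ks →* Gal(Ks/K) := (weilSubgroup K Ks).subtype

/-- The topology of the Weil group: the coarsest one for which the inclusion in `Gal(Ks/K)` (with
the Krull topology) and the map to the *discrete* group of automorphisms of the residue field are
continuous. So the inertia group is open in it, and carries the Krull topology. -/
noncomputable instance : TopologicalSpace (WeilGroup K Ks) :=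
  TopologicalSpace.induced (toGal K Ks) inferInstance ⊓
    TopologicalSpace.induced ((residueAction K Ks).comp (toGal K Ks)) ⊥

end WeilGroup

end Weil

section Representations

variable {K : Type*} [Field K] [ValuativeRel K] [TopologicalSpace K]
  [IsNonarchimedeanLocalField K] {Ks : Type*} [Field Ks] [Algebra K Ks] [IsSepClosure K Ks]

/-- A complex representation of the Weil group of `K` is a Weil representation if it is
finite-dimensional and continuous, i.e. its matrix coefficients are continuous functions for the
usual topology of `ℂ`. -/
structure IsWeilRepresentation {V : Type*} [AddCommGroup V] [Module ℂ V]
    (ρ : Representation ℂ (WeilGroup K Ks) V) : Prop where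
  finiteDimensional : FiniteDimensional ℂ V
  continuous_coeff : ∀ (f : Module.Dual ℂ V) (v : V), Continuous fun w => f (ρ w v)

/-- `ρ` is unramified over `L` if the inertia group `I_L`, i.e. the intersection of `I_K` with the
subgroup `Gal(Ks/L)`, acts trivially. -/
def IsUnramifiedOver {V : Type*} [AddCommGroup V] [Module ℂ V]
    (ρ : Representation ℂ (WeilGroup K Ks) V) (L : IntermediateField K Ks) : Prop :=
  ∀ w : WeilGroup K Ks, WeilGroup.toGal K Ks w ∈ inertiaGroup K Ks ⊓ L.fixingSubgroup → ρ w = 1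

/-- `w` is an arithmetic Frobenius element `Frob_L` of `L`: it lies in `Gal(Ks/L)` and acts on the
residue field of `Ks` as `x ↦ x ^ q`, where `q` is the number of elements of the residue field
of `L`. -/
def IsFrobeniusOver (w : WeilGroup K Ks) (L : IntermediateField K Ks) : Prop :=
  WeilGroup.toGal K Ks w ∈ L.fixingSubgroup ∧
    ∀ x : ResField K Ks, residueAction K Ks (WeilGroup.toGal K Ks w) x = x ^ Nat.card (ResField K L)

end Representations

end LocalWeil

/-! ### Semisimple modules and their traces -/

section BrauerNesbitt

variable {R : Type*} [Ring R] {V W : Type*} [AddCommGroup V] [Module R V]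
  [AddCommGroup W] [Module R W]

/-! In characteristic zero, finite-dimensional semisimple representations are determined by their
characters (`Representation.nonempty_equiv_of_trace_eq`), so it suffices to show tr ρ₁(w) = tr ρ₂(w)
for every w in the Weil group. By continuity and the absence of small subgroups in a matrix algebra,
both ρᵢ are trivial on I_M for some finite M (`IsWeilRepresentation.exists_finiteDimensional`).

If w acts on k_s as Frob^n with n > 0, it is an arithmetic Frobenius element of some finite L with
I_L ⊆ I_M (`exists_isFrobeniusOver`): L is the fixed field of the open subgroup generated by w and a
small normal subgroup, and Teichmüller representatives show that its residue field has q^n elements.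
The hypothesis then applies to w.

For general w, multiply by powers of a Frobenius lift φ to reach positive degree. By Cayley–Hamilton
for the invertible ρᵢ(φ^N), the trace at w is a linear combination of the traces at w φ^(N(k+1)), k
≥ 0, with the same coefficients for both representations (`LinearMap.trace_eq_of_forall_mul_pow`).
-/

theorem IsSemisimpleModule.prod [IsSemisimpleModule R V] [IsSemisimpleModule R W] :
    IsSemisimpleModule R (V × W) := by
  have h := IsSemisimpleModule.sup (IsSemisimpleModule.range (LinearMap.inl R V W))
    (IsSemisimpleModule.range (LinearMap.inr R V W))
  rw [LinearMap.sup_range_inl_inr] at h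
  exact IsSemisimpleModule.congr Submodule.topEquiv.symm

/-- A projection of V × W onto N has zero off-diagonal blocks, hence respects both factors. As it
fixes (v, w), it fixes (v, 0). -/
theorem Submodule.mk_zero_mem_of_forall_hom_eq_zero [IsSemisimpleModule R V]
    [IsSemisimpleModule R W] (h₁ : ∀ f : V →ₗ[R] W, f = 0)
    (N : Submodule R (V × W)) {v : V} {w : W} (h : (v, w) ∈ N)
    (h₂ : ∀ f : W →ₗ[R] V, f = 0) : (v, (0 : W)) ∈ N := by
  have := IsSemisimpleModule.prod (R := R) (V := V) (W := W)
  obtain ⟨C, hC⟩ := ComplementedLattice.exists_isCompl N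
  let p := N.projectionOnto C hC
  have hp : ((p (v, w) : V × W)) = (v, w) :=
    congrArg Subtype.val (Submodule.projectionOnto_apply_left hC ⟨(v, w), h⟩)
  have hadd : p (v, w) = p (v, 0) + p (0, w) := by rw [← map_add]; simp
  have e1 := LinearMap.congr_fun (h₁ (LinearMap.snd R V W ∘ₗ N.subtype ∘ₗ p ∘ₗ LinearMap.inl R V W)) v
  have e2 := LinearMap.congr_fun (h₂ (LinearMap.fst R V W ∘ₗ N.subtype ∘ₗ p ∘ₗ LinearMap.inr R V W)) w
  have : ((p (v, 0) : N) : V × W) = (v, 0) := by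
    rw [hadd] at hp
    simp at e1 e2
    ext
    · have := congrArg Prod.fst hp
      simpa [e2] using this
    · simpa using e1
  rw [← this]
  exact (p (v, 0)).2

/-- A density argument: there are still no homomorphisms between the powers of V and W, so the
cyclic submodule generated by (v, w) contains (v, 0). -/
theorem exists_smul_eq_self_and_smul_eq_zero [IsSemisimpleModule R V]
    [IsSemisimpleModule R W] (h₁ : ∀ f : V →ₗ[R] W, f = 0) (h₂ : ∀ f : W →ₗ[R] V, f = 0)
    {ι κ : Type*} [Finite ι] [Finite κ] (v : ι → V) (w : κ → W) :
    ∃ r : R, (∀ i, r • v i = v i) ∧ ∀ j, r • w j = 0 := by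
  have key := Submodule.mk_zero_mem_of_forall_hom_eq_zero (R := R) (V := ι → V) (W := κ → W)
    (fun f => ?_) (R ∙ (v, w)) (Submodule.mem_span_singleton_self _) fun f => ?_
  · obtain ⟨r, hr⟩ := Submodule.mem_span_singleton.1 key
    exact ⟨r, congrFun (congrArg Prod.fst hr), congrFun (congrArg Prod.snd hr)⟩
  · classical
    refine LinearMap.pi_ext' fun i => LinearMap.ext fun x => funext fun j => ?_
    exact LinearMap.congr_fun (h₁ (LinearMap.proj j ∘ₗ f ∘ₗ LinearMap.single R (fun _ => V) i)) x
  · classical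
    refine LinearMap.pi_ext' fun i => LinearMap.ext fun x => funext fun j => ?_
    exact LinearMap.congr_fun (h₂ (LinearMap.proj j ∘ₗ f ∘ₗ LinearMap.single R (fun _ => W) i)) x

variable (k : Type*) [Field k] [Algebra k R] [Module k V] [IsScalarTower k R V]
  [Module k W] [IsScalarTower k R W]

theorem trace_lsmul_congr (e : V ≃ₗ[R] W) (r : R) :
    LinearMap.trace k V (Algebra.lsmul k k V r) = LinearMap.trace k W (Algebra.lsmul k k W r) := by
  rw [← LinearMap.trace_conj' _ (e.restrictScalars k)]
  congr 1
  ext x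
  simp [LinearEquiv.conj_apply]

theorem trace_lsmul_prod [FiniteDimensional k V] [FiniteDimensional k W] (r : R) :
    LinearMap.trace k (V × W) (Algebra.lsmul k k (V × W) r) =
      LinearMap.trace k V (Algebra.lsmul k k V r) +
      LinearMap.trace k W (Algebra.lsmul k k W r) := by
  rw [← LinearMap.trace_prodMap']
  rfl

theorem finiteDimensional_submodule_of_algebra [FiniteDimensional k V] (N : Submodule R V) :
    FiniteDimensional k N :=
  inferInstanceAs (FiniteDimensional k (N.restrictScalars k))

/-- Some r acts as 1 on V and as 0 on W; comparing its traces gives dim V = 0 in k. -/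
theorem finrank_eq_zero_of_forall_hom_eq_zero [CharZero k] [FiniteDimensional k V]
    [FiniteDimensional k W] [IsSemisimpleModule R V]
    [IsSemisimpleModule R W] (h₁ : ∀ f : V →ₗ[R] W, f = 0) (h₂ : ∀ f : W →ₗ[R] V, f = 0)
    (htr : ∀ r : R, LinearMap.trace k V (Algebra.lsmul k k V r) =
      LinearMap.trace k W (Algebra.lsmul k k W r)) : Module.finrank k V = 0 := by
  obtain ⟨r, hr, hr'⟩ := exists_smul_eq_self_and_smul_eq_zero h₁ h₂
    (Module.finBasis k V) (Module.finBasis k W)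
  have e1 : Algebra.lsmul k k V r = 1 := (Module.finBasis k V).ext fun i => by simpa using hr i
  have e2 : Algebra.lsmul k k W r = 0 := (Module.finBasis k W).ext fun i => by simpa using hr' i
  have := htr r
  rw [e1, e2, map_zero, LinearMap.trace_one] at this
  exact_mod_cast this

/-- If there is a nonzero homomorphism between two semisimple modules, they have isomorphic
nonzero direct summands. -/
theorem exists_common_summand [IsSemisimpleModule R V]
    [IsSemisimpleModule R W] (f : V →ₗ[R] W) :
    ∃ (V' : Submodule R V) (W' : Submodule R W), Nonempty (V ≃ₗ[R] f.range × V') ∧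
      Nonempty (W ≃ₗ[R] f.range × W') := by
  obtain ⟨C, hC⟩ := exists_isCompl f.ker
  obtain ⟨D, hD⟩ := exists_isCompl f.range
  refine ⟨f.ker, D, ⟨?_⟩, ⟨(Submodule.prodEquivOfIsCompl _ _ hD).symm⟩⟩
  refine (Submodule.prodEquivOfIsCompl _ _ hC.symm).symm ≪≫ₗ LinearEquiv.prodCongr ?_ (.refl _ _)
  exact (Submodule.quotientEquivOfIsCompl _ _ hC).symm ≪≫ₗ f.quotKerEquivRange

/-- The **Brauer–Nesbitt theorem** in characteristic zero: finite-dimensional semisimple modules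
over an algebra are determined by their traces. -/
theorem nonempty_linearEquiv_of_trace_eq [CharZero k] [FiniteDimensional k V]
    [FiniteDimensional k W] [IsSemisimpleModule R V] [IsSemisimpleModule R W]
    (htr : ∀ r : R, LinearMap.trace k V (Algebra.lsmul k k V r) =
      LinearMap.trace k W (Algebra.lsmul k k W r)) : Nonempty (V ≃ₗ[R] W) := by
  induction hn : Module.finrank k V using Nat.strong_induction_on generalizing V W with
  | _ n ih =>
  by_cases h : ∃ f : V →ₗ[R] W, f ≠ 0
  · obtain ⟨f, hf⟩ := h
    obtain ⟨V', W', ⟨e₁⟩, ⟨e₂⟩⟩ := exists_common_summand f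
    have := finiteDimensional_submodule_of_algebra k f.range
    have := finiteDimensional_submodule_of_algebra k V'
    have := finiteDimensional_submodule_of_algebra k W'
    have h1 := (e₁.restrictScalars k).finrank_eq
    rw [Module.finrank_prod] at h1
    have h2 : 0 < Module.finrank k f.range := by
      rw [Module.finrank_pos_iff, Submodule.nontrivial_iff_ne_bot]
      exact fun h => hf (LinearMap.range_eq_bot.1 h)
    -- Cancelling the common summand keeps the traces equal and lowers the dimension.
    obtain ⟨e⟩ := ih (Module.finrank k V') (by omega) (V := V') (W := W') (fun r => by
      have := htr r
      rw [trace_lsmul_congr k e₁, trace_lsmul_congr k e₂, trace_lsmul_prod, trace_lsmul_prod] at this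
      exact add_left_cancel this) rfl
    exact ⟨e₁ ≪≫ₗ LinearEquiv.prodCongr (.refl _ _) e ≪≫ₗ e₂.symm⟩
  · push Not at h
    -- The image of a nonzero g is a summand of both modules, so projecting V onto it and including
    -- it in W would give a nonzero map V → W.
    have h' : ∀ g : W →ₗ[R] V, g = 0 := fun g => by
      obtain ⟨W', V', ⟨e₂⟩, ⟨e₁⟩⟩ := exists_common_summand g
      have := h (e₂.symm.toLinearMap ∘ₗ LinearMap.inl R _ _ ∘ₗ LinearMap.fst R _ _ ∘ₗ
        e₁.toLinearMap)
      rw [← LinearMap.range_eq_bot, Submodule.eq_bot_iff]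
      intro x hx
      have := LinearMap.congr_fun this (e₁.symm (⟨x, hx⟩, 0))
      simpa using this
    have h1 := finrank_eq_zero_of_forall_hom_eq_zero k h h' htr
    have h2 := finrank_eq_zero_of_forall_hom_eq_zero k h' h fun r => (htr r).symm
    rw [Module.finrank_zero_iff] at h1 h2
    exact ⟨0⟩

end BrauerNesbitt

/-! ### Characters of group representations, and two facts of linear algebra -/

theorem Representation.trace_lsmul_single {k G V : Type*} [Field k] [Monoid G]
    [AddCommGroup V] [Module k V] (ρ : Representation k G V) (g : G) :
    LinearMap.trace k ρ.asModule (Algebra.lsmul k k ρ.asModule (MonoidAlgebra.single g (1 : k))) =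
      LinearMap.trace k V (ρ g) := by
  rw [← LinearMap.trace_conj' _ ρ.asModuleEquiv]
  congr 1
  ext x
  simp only [LinearEquiv.conj_apply_apply, Algebra.lsmul_coe]
  rw [asModuleEquiv_map_smul, LinearEquiv.apply_symm_apply, asAlgebraHom_single, one_smul]

open scoped MonoidAlgebra in
/-- Finite-dimensional semisimple representations in characteristic zero are determined by their
traces. -/
theorem Representation.nonempty_equiv_of_trace_eq {k G V W : Type*} [Field k] [CharZero k] [Group G]
    [AddCommGroup V] [Module k V] [AddCommGroup W] [Module k W] [FiniteDimensional k V]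
    [FiniteDimensional k W] (ρ : Representation k G V) (σ : Representation k G W)
    (hρ : ρ.IsSemisimpleRepresentation) (hσ : σ.IsSemisimpleRepresentation)
    (htr : ∀ g, LinearMap.trace k V (ρ g) = LinearMap.trace k W (σ g)) :
    Nonempty (ρ.Equiv σ) := by
  rw [isSemisimpleRepresentation_iff_isSemisimpleModule_asModule] at hρ hσ
  have : FiniteDimensional k ρ.asModule := inferInstanceAs (FiniteDimensional k V)
  have : FiniteDimensional k σ.asModule := inferInstanceAs (FiniteDimensional k W)
  have key : LinearMap.trace k ρ.asModule ∘ₗ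
        (Algebra.lsmul k k ρ.asModule : k[G] →ₐ[k] _).toLinearMap =
      LinearMap.trace k σ.asModule ∘ₗ
        (Algebra.lsmul k k σ.asModule : k[G] →ₐ[k] _).toLinearMap := by
    refine MonoidAlgebra.lhom_ext' fun g => LinearMap.ext_ring ?_
    exact (ρ.trace_lsmul_single g).trans ((htr g).trans (σ.trace_lsmul_single g).symm)
  obtain ⟨e⟩ := nonempty_linearEquiv_of_trace_eq (R := k[G]) k (V := ρ.asModule)
    (W := σ.asModule) (LinearMap.congr_fun key)
  refine ⟨.mk (ρ.asModuleEquiv.symm ≪≫ₗ e.restrictScalars k ≪≫ₗ σ.asModuleEquiv) fun g => ?_⟩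
  refine LinearMap.ext fun x => ?_
  have h := e.map_smul (MonoidAlgebra.of k G g) (ρ.asModuleEquiv.symm x)
  rw [← asModuleEquiv_symm_map_rho] at h
  change σ.asModuleEquiv (e (ρ.asModuleEquiv.symm (ρ g x))) =
    σ g (σ.asModuleEquiv (e (ρ.asModuleEquiv.symm x)))
  rw [h, asModuleEquiv_map_smul, asAlgebraHom_of]

/-- A normed algebra has no small subgroups. -/
theorem eq_one_of_forall_norm_sub_one_le {A : Type*} [NormedRing A] [NormedSpace ℝ A] {S : Set A}
    (hS : ∀ a ∈ S, a * a ∈ S) (h : ∀ a ∈ S, ‖a - 1‖ ≤ 1 / 2) {a : A} (ha : a ∈ S) : a = 1 := by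
  have key : ∀ n : ℕ, ∀ b ∈ S, ‖b - 1‖ ≤ (3 / 4) ^ n * (1 / 2) := by
    intro n
    induction n with
    | zero => simpa using h
    | succ n ih =>
      intro b hb
      -- If C bounds ‖x - 1‖ on S, then with ‖b - 1‖ ≤ 1/2 this identity gives 2‖b - 1‖ ≤ C + C/2,
      -- whence the factor 3/4.
      have e : (2 : ℝ) • (b - 1) = (b * b - 1) - (b - 1) * (b - 1) := by
        rw [two_smul]; noncomm_ring
      have h1 : 2 * ‖b - 1‖ ≤ ‖b * b - 1‖ + ‖b - 1‖ * ‖b - 1‖ := by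
        have h2 := (norm_sub_le (b * b - 1) ((b - 1) * (b - 1))).trans
          (add_le_add_right (norm_mul_le _ _) _)
        rwa [← e, norm_smul, Real.norm_ofNat] at h2
      have h2 := ih _ (hS b hb)
      have h3 := ih b hb
      have h4 := h b hb
      rw [pow_succ]
      nlinarith [norm_nonneg (b - 1)]
  have hlim : Filter.Tendsto (fun n : ℕ => ((3 / 4 : ℝ)) ^ n * (1 / 2)) Filter.atTop
      (nhds (0 * (1 / 2))) :=
    (tendsto_pow_atTop_nhds_zero_of_lt_one (by norm_num) (by norm_num)).mul_const _
  rw [zero_mul] at hlim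
  have := ge_of_tendsto' hlim fun n => key n a ha
  exact sub_eq_zero.1 (norm_le_zero_iff.1 this)

/-- If `A * A' ^ n` and `B * B' ^ n` have the same trace for all `n ≥ 1`, with `A'` and `B'`
invertible, then `A` and `B` have the same trace. -/
theorem LinearMap.trace_eq_of_forall_mul_pow {k V W : Type*} [Field k]
    [AddCommGroup V] [Module k V] [AddCommGroup W] [Module k W] [FiniteDimensional k V]
    [FiniteDimensional k W] {A A' : Module.End k V} {B B' : Module.End k W}
    (hA : IsUnit A') (hB : IsUnit B')
    (h : ∀ n : ℕ, LinearMap.trace k V (A * A' ^ (n + 1)) = LinearMap.trace k W (B * B' ^ (n + 1))) :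
    LinearMap.trace k V A = LinearMap.trace k W B := by
  -- One polynomial killing both A' and B', with nonzero constant term: p - p(0) is divisible by X
  -- and acts as the scalar -p(0).
  let p := A'.charpoly * B'.charpoly
  have hpA : Polynomial.aeval A' p = 0 := by simp [p, LinearMap.aeval_self_charpoly]
  have hpB : Polynomial.aeval B' p = 0 := by simp [p, LinearMap.aeval_self_charpoly]
  have h0 : p.coeff 0 ≠ 0 := by
    rw [Polynomial.mul_coeff_zero]
    rw [LinearMap.isUnit_iff_isUnit_det, LinearMap.det_eq_sign_charpoly_coeff] at hA hB
    exact mul_ne_zero (right_ne_zero_of_mul hA.ne_zero) (right_ne_zero_of_mul hB.ne_zero)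
  have key : ∀ q : Polynomial k, LinearMap.trace k V (A * Polynomial.aeval A' (q * Polynomial.X)) =
      LinearMap.trace k W (B * Polynomial.aeval B' (q * Polynomial.X)) := by
    intro q
    induction q using Polynomial.induction_on' with
    | add q r hq hr => simp only [add_mul, map_add, mul_add, hq, hr]
    | monomial n c =>
      rw [Polynomial.monomial_mul_X, Polynomial.aeval_monomial, Polynomial.aeval_monomial,
        ← Algebra.smul_def, ← Algebra.smul_def, mul_smul_comm, mul_smul_comm, map_smul, map_smul, h]
  have := key p.divX
  have e : p.divX * Polynomial.X = p - Polynomial.C (p.coeff 0) :=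
    eq_sub_of_add_eq p.divX_mul_X_add
  rw [e, map_sub, map_sub, hpA, hpB, Polynomial.aeval_C, Polynomial.aeval_C,
    Algebra.algebraMap_eq_smul_one, Algebra.algebraMap_eq_smul_one] at this
  simpa [h0] using this

/-! ### Weil representations are trivial on an open subgroup of inertia -/

namespace LocalWeil
open Filter Topology

section
variable (K : Type*) [Field K] [ValuativeRel K] [TopologicalSpace K]
  [IsNonarchimedeanLocalField K] (Ks : Type*) [Field Ks] [Algebra K Ks] [IsSepClosure K Ks]

theorem WeilGroup.nhds_one : 𝓝 (1 : WeilGroup K Ks) =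
    comap (toGal K Ks) (𝓝 1) ⊓ 𝓟 {w | toGal K Ks w ∈ inertiaGroup K Ks} := by
  let : TopologicalSpace (RingAut (ResField K Ks)) := ⊥
  have : DiscreteTopology (RingAut (ResField K Ks)) := ⟨rfl⟩
  refine (nhds_inf (t₁ := TopologicalSpace.induced (toGal K Ks) inferInstance)
    (t₂ := TopologicalSpace.induced ((residueAction K Ks).comp (toGal K Ks)) ⊥)).trans ?_
  rw [nhds_induced, nhds_induced, map_one, nhds_discrete (RingAut (ResField K Ks)),
    comap_pure]
  congr 1
  congr 1
  ext w
  simp [inertiaGroup, MonoidHom.mem_ker]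
end

variable {K : Type*} [Field K] [ValuativeRel K] [TopologicalSpace K]
  [IsNonarchimedeanLocalField K] {Ks : Type*} [Field Ks] [Algebra K Ks] [IsSepClosure K Ks]

-- By continuity ‖ρ(w) - 1‖ ≤ 1/2 on some I_K ∩ Gal(Ks/M). This is a subgroup, so its image is
-- trivial, there being no small subgroups.
attribute [local instance] Matrix.linftyOpNormedRing Matrix.linftyOpNormedAlgebra in
theorem IsWeilRepresentation.exists_finiteDimensional {V : Type*} [AddCommGroup V] [Module ℂ V]
    {ρ : Representation ℂ (WeilGroup K Ks) V} (hρ : IsWeilRepresentation ρ) :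
    ∃ M : IntermediateField K Ks, FiniteDimensional K M ∧ IsUnramifiedOver ρ M := by
  have := hρ.finiteDimensional
  let b := Module.finBasis ℂ V
  let T := LinearMap.toMatrixAlgEquiv b
  have hcont : Continuous fun w => T (ρ w) := by
    refine continuous_matrix fun i j => ?_
    simpa [T, LinearMap.toMatrixAlgEquiv_apply] using hρ.continuous_coeff (b.coord i) (b j)
  have hnear : ∀ᶠ w in 𝓝 (1 : WeilGroup K Ks), ‖T (ρ w) - 1‖ ≤ 1 / 2 := by
    have h0 : Tendsto (fun w => ‖T (ρ w) - 1‖) (𝓝 1) (𝓝 0) := by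
      have := ((hcont.sub continuous_const).norm (f := fun w => T (ρ w) - 1)).tendsto 1
      simpa using this
    exact h0.eventually_le_const (by norm_num)
  rw [WeilGroup.nhds_one, eventually_inf_principal, eventually_comap] at hnear
  obtain ⟨M, hM, hM'⟩ := (krullTopology_mem_nhds_one_iff K Ks _).1 hnear
  refine ⟨M, hM, fun w hw => T.injective ?_⟩
  rw [map_one]
  refine eq_one_of_forall_norm_sub_one_le (S := {a | ∃ w : WeilGroup K Ks,
    WeilGroup.toGal K Ks w ∈ inertiaGroup K Ks ⊓ M.fixingSubgroup ∧ a = T (ρ w)}) ?_ ?_ ⟨w, hw, rfl⟩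
  · rintro _ ⟨w, hw, rfl⟩
    exact ⟨w * w, by rw [map_mul]; exact mul_mem hw hw, by rw [map_mul, map_mul]⟩
  · rintro _ ⟨w, hw, rfl⟩
    exact hM' hw.2 w rfl hw.1

end LocalWeil

/-! ### Teichmüller representatives and residue fields -/

namespace LocalWeil
open IsLocalRing

section Teichmuller

variable (K : Type*) [Field K] [ValuativeRel K] [TopologicalSpace K]
  [IsNonarchimedeanLocalField K] (L : Type*) [Field L] [Algebra K L] [Algebra.IsAlgebraic K L]

theorem natCast_card_pow_eq_zero {n : ℕ} (hn : n ≠ 0) :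
    ((Nat.card 𝓀[K] ^ n : ℕ) : ResField K L) = 0 := by
  have : Fintype 𝓀[K] := Fintype.ofFinite _
  have h : ((Nat.card 𝓀[K] ^ n : ℕ) : 𝓀[K]) = 0 := by
    rw [Nat.card_eq_fintype_card, Nat.cast_pow, FiniteField.cast_card_eq_zero, zero_pow hn]
  rw [← map_natCast (algebraMap 𝓀[K] (ResField K L)), h, map_zero]

variable {K L}

/-- Roots of `X ^ N - X` in the ring of integers are determined by their residues. -/
theorem eq_of_residue_eq_of_pow_eq {N : ℕ} (hN : (N : ResField K L) = 0)
    {a b : integralClosure 𝒪[K] L} (ha : a ^ N = a) (hb : b ^ N = b)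
    (h : residue _ a = residue _ b) : a = b := by
  -- Here a - b = a^N - b^N = s(a - b), and s reduces to N·a^(N-1) = 0, so 1 - s is a unit.
  have e := (Commute.all a b).geom_sum₂_mul N
  rw [ha, hb] at e
  set s := ∑ i ∈ Finset.range N, a ^ i * b ^ (N - 1 - i)
  have hs : residue _ s = 0 := by
    simp only [s, map_sum, map_mul, map_pow, h]
    rw [geom_sum₂_self, hN, zero_mul]
  have hu : IsUnit (1 - s) := by
    by_contra hu
    rw [← mem_nonunits_iff, ← mem_maximalIdeal, ← residue_eq_zero_iff, map_sub, hs] at hu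
    simp at hu
  have h0 : (1 - s) * (a - b) = 0 := by rw [sub_mul, e, one_mul, sub_self]
  exact sub_eq_zero.1 (hu.mul_right_eq_zero.1 h0)

theorem residueAction_residue (g : Gal(L/K)) (a : integralClosure 𝒪[K] L) :
    residueAction K L g (residue _ a) = residue _ (g • a) := rfl

theorem smul_eq_of_residueAction_eq {N : ℕ} (hN : (N : ResField K L) = 0) {g : Gal(L/K)}
    {a : integralClosure 𝒪[K] L} (ha : a ^ N = a)
    (h : residueAction K L g (residue _ a) = residue _ a) : g • a = a :=
  eq_of_residue_eq_of_pow_eq hN (by rw [← smul_pow', ha]) ha h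

theorem finite_setOf_pow_eq_and_ncard_le {F : Type*} [Field F] {N : ℕ} (hN : 1 < N) :
    {a : F | a ^ N = a}.Finite ∧ {a : F | a ^ N = a}.ncard ≤ N := by
  classical
  have h0 := FiniteField.X_pow_card_sub_X_ne_zero F hN
  have h := Polynomial.card_roots' (Polynomial.X ^ N - Polynomial.X : Polynomial F)
  rw [FiniteField.X_pow_card_sub_X_natDegree_eq _ hN] at h
  have hsub : {a : F | a ^ N = a} ⊆
      (Polynomial.X ^ N - Polynomial.X : Polynomial F).roots.toFinset := fun a ha => by
    have ha : a ^ N = a := ha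
    simp [h0, ha]
  refine ⟨(Finset.finite_toSet _).subset hsub,
    le_trans ?_ ((Multiset.toFinset_card_le _).trans h)⟩
  rw [← Set.ncard_coe_finset]
  exact Set.ncard_le_ncard hsub (Finset.finite_toSet _)

open Polynomial in
theorem separable_X_pow_sub_X {F : Type*} [Field F] {N : ℕ} (hN : 1 < N) (h : (N : F) - 1 ≠ 0) :
    (X ^ N - X : F[X]).Separable := by
  obtain ⟨n, rfl⟩ := Nat.exists_eq_add_of_le' hN
  rw [separable_def, isCoprime_comm]
  have h1 : (C ((n + 2 : ℕ) : F) - 1) * C (((n + 2 : ℕ) : F) - 1)⁻¹ = 1 := by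
    rw [← C_1, ← C_sub, ← C_mul, mul_inv_cancel₀ h]
  have h2 : derivative (X ^ (n + 2) - X : F[X]) = C ((n + 2 : ℕ) : F) * X ^ (n + 1) - 1 := by
    rw [derivative_sub, derivative_X_pow, derivative_X, Nat.add_sub_cancel (n + 1) 1]
  rw [h2]
  generalize C ((n + 2 : ℕ) : F) = N at *
  generalize C (((n + 2 : ℕ) : F) - 1)⁻¹ = c at *
  -- With f = X^N - X one has X f' - N f = (N - 1) X, so X lies in (f, f'), and then so does 1 = N
  -- X^(N-1) - f'.
  refine ⟨c * N * X ^ n * X - 1, -(c * N * X ^ n * N), ?_⟩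
  linear_combination (N * X ^ n * X) * h1

end Teichmuller

section SepClosure

variable {K : Type*} [Field K] [ValuativeRel K] [TopologicalSpace K]
  [IsNonarchimedeanLocalField K] {Ks : Type*} [Field Ks] [Algebra K Ks] [IsSepClosure K Ks]

theorem ncard_integralClosure_setOf_pow_eq {N : ℕ} (hN : 1 < N) (h0 : (N : ResField K Ks) = 0) :
    {a : integralClosure 𝒪[K] Ks | a ^ N = a}.ncard = N := by
  have : IsSepClosed Ks := IsSepClosure.sep_closed K
  have hs : (N : Ks) - 1 ≠ 0 := by
    intro h
    have h1 : ((N : integralClosure 𝒪[K] Ks) - 1) = 0 := Subtype.ext (by simpa using h)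
    simpa [h0] using congrArg (residue _) h1
  have hsep := separable_X_pow_sub_X hN hs
  have hcard := Polynomial.card_rootSet_eq_natDegree (K := Ks) hsep
    (by simpa using IsSepClosed.splits_of_separable _ hsep)
  rw [FiniteField.X_pow_card_sub_X_natDegree_eq _ hN, ← Nat.card_eq_fintype_card,
    Nat.card_coe_set_eq] at hcard
  rw [← Set.ncard_image_of_injective _ Subtype.val_injective]
  refine (congrArg Set.ncard ?_).trans hcard
  have hne := FiniteField.X_pow_card_sub_X_ne_zero Ks hN
  ext x
  rw [Polynomial.mem_rootSet]
  constructor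
  · rintro ⟨a, ha, rfl⟩
    refine ⟨hne, ?_⟩
    have := congrArg Subtype.val ha
    simpa [sub_eq_zero] using this
  · rintro ⟨-, hx⟩
    have hx' : x ^ N = x := by simpa [sub_eq_zero] using hx
    refine ⟨⟨x, Polynomial.X ^ N - Polynomial.X, Polynomial.monic_X_pow_sub
      (by simpa using hN), by simp [hx']⟩, Subtype.ext hx', rfl⟩

/-- Counting replaces Hensel's lemma: reduction is injective on the N integral roots, and X^N - X
has at most N roots in the residue field. -/
theorem exists_residue_eq_of_pow_eq {N : ℕ} (hN : 1 < N) (h0 : (N : ResField K Ks) = 0)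
    {x : ResField K Ks} (hx : x ^ N = x) :
    ∃ a : integralClosure 𝒪[K] Ks, a ^ N = a ∧ residue _ a = x := by
  have himg : residue _ '' {a : integralClosure 𝒪[K] Ks | a ^ N = a} = {x | x ^ N = x} := by
    refine Set.eq_of_subset_of_ncard_le ?_ ?_ (finite_setOf_pow_eq_and_ncard_le hN).1
    · rintro _ ⟨a, ha, rfl⟩
      exact (map_pow _ _ _).symm.trans (congrArg _ ha)
    · rw [Set.InjOn.ncard_image, ncard_integralClosure_setOf_pow_eq hN h0]
      · exact (finite_setOf_pow_eq_and_ncard_le hN).2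
      · exact fun a ha b hb => eq_of_residue_eq_of_pow_eq h0 ha hb
  exact himg.ge hx

theorem ncard_resField_setOf_pow_eq {N : ℕ} (hN : 1 < N) (h0 : (N : ResField K Ks) = 0) :
    {x : ResField K Ks | x ^ N = x}.ncard = N := by
  refine le_antisymm (finite_setOf_pow_eq_and_ncard_le hN).2 ?_
  refine (ncard_integralClosure_setOf_pow_eq hN h0).ge.trans ?_
  exact Set.ncard_le_ncard_of_injOn (residue _) (fun a ha => (map_pow _ _ _).symm.trans (congrArg _ ha))
    (fun a ha b hb => eq_of_residue_eq_of_pow_eq h0 ha hb) (finite_setOf_pow_eq_and_ncard_le hN).1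

/-- The residue field of a subextension `L` has `N` elements if `L` is fixed by an automorphism
acting as `x ↦ x ^ N` on residues, and contains the roots of `X ^ N - X`. -/
theorem card_resField_eq {N : ℕ} (hN : 1 < N) (h0 : (N : ResField K Ks) = 0)
    (L : IntermediateField K Ks) {g : Gal(Ks/K)} (hg : g ∈ L.fixingSubgroup)
    (hact : ∀ x, residueAction K Ks g x = x ^ N)
    (hL : ∀ a : integralClosure 𝒪[K] Ks, a ^ N = a → (a : Ks) ∈ L) :
    Nat.card (ResField K L) = N := by
  let i : integralClosure 𝒪[K] L →ₐ[𝒪[K]] integralClosure 𝒪[K] Ks :=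
    (L.val.restrictScalars 𝒪[K]).mapIntegralClosure
  have hi : ∀ a, ((i a : integralClosure 𝒪[K] Ks) : Ks) = ((a : L) : Ks) := fun a => rfl
  have hinj : Function.Injective i := fun a b h => Subtype.ext (Subtype.ext (congrArg
    (Subtype.val : integralClosure 𝒪[K] Ks → Ks) h))
  have hloc : IsLocalHom (i : integralClosure 𝒪[K] L →+* integralClosure 𝒪[K] Ks) := by
    refine RingHom.IsIntegral.isLocalHom (RingHom.IsIntegral.tower_top
      (algebraMap 𝒪[K] (integralClosure 𝒪[K] L)) _ ?_) hinj
    rw [i.comp_algebraMap]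
    exact algebraMap_isIntegral_iff.2 inferInstance
  let f := ResidueField.map (i : integralClosure 𝒪[K] L →+* integralClosure 𝒪[K] Ks)
  -- Residues of L satisfy x^N = x because g fixes L; conversely each such x has its Teichmüller
  -- representative in L.
  have hr : Set.range f = {x | x ^ N = x} := by
    ext x
    constructor
    · rintro ⟨y, rfl⟩
      obtain ⟨a, rfl⟩ := residue_surjective y
      rw [Set.mem_ofPred_eq, ← hact, ResidueField.map_residue, residueAction_residue]
      congr 1
      exact Subtype.ext (hg a)
    · intro hx
      obtain ⟨a, ha, rfl⟩ := exists_residue_eq_of_pow_eq hN h0 hx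
      have hint : IsIntegral 𝒪[K] (⟨a, hL a ha⟩ : L) := by
        have := a.2
        exact (isIntegral_algHom_iff (L.val.restrictScalars 𝒪[K]) L.val.injective).1 this
      exact ⟨residue _ ⟨⟨a, hL a ha⟩, hint⟩, rfl⟩
  rw [← ncard_resField_setOf_pow_eq hN h0, ← hr, ← Nat.card_coe_set_eq]
  exact Nat.card_congr (Equiv.ofInjective f f.injective)

theorem residueFrobenius_pow_apply (n : ℕ) (x : ResField K Ks) :
    (residueFrobenius K Ks ^ n) x = x ^ Nat.card 𝓀[K] ^ n := by
  induction n with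
  | zero => simp
  | succ n ih => rw [pow_succ', RingAut.mul_apply, residueFrobenius_apply, ih, ← pow_mul, pow_succ]

/-- The Galois group is profinite, acts continuously on the discrete ring of integers and has
invariants 𝒪[K]; hence the stabilizer of the maximal ideal surjects onto the automorphisms of the
residue extension. -/
theorem exists_residueAction_eq_residueFrobenius :
    ∃ g : Gal(Ks/K), residueAction K Ks g = residueFrobenius K Ks := by
  let : TopologicalSpace (integralClosure 𝒪[K] Ks) := ⊥
  have : DiscreteTopology (integralClosure 𝒪[K] Ks) := ⟨rfl⟩
  have : ContinuousSMul Gal(Ks/K) (integralClosure 𝒪[K] Ks) := by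
    rw [continuousSMul_iff_stabilizer_isOpen]
    intro x
    convert stabilizer_isOpen_of_isIntegral (K := K) (x : Ks) using 1
    ext g
    simp [MulAction.mem_stabilizer_iff, Subtype.ext_iff]
  have : Algebra.IsInvariant 𝒪[K] (integralClosure 𝒪[K] Ks) Gal(Ks/K) := by
    refine ⟨fun b hb => ?_⟩
    obtain ⟨x, hx⟩ := Algebra.IsInvariant.isInvariant (A := K) (G := Gal(Ks/K)) (b : Ks)
      fun g => congrArg Subtype.val (hb g)
    have hx' : IsIntegral 𝒪[K] x := by
      rw [← isIntegral_algebraMap_iff (algebraMap K Ks).injective, hx]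
      exact b.2
    obtain ⟨y, rfl⟩ := IsIntegrallyClosed.isIntegral_iff.1 hx'
    exact ⟨y, Subtype.ext hx⟩
  let : Fintype 𝓀[K] := Fintype.ofFinite _
  obtain ⟨g, hg⟩ := Ideal.Quotient.stabilizerHom_surjective_of_profinite (G := Gal(Ks/K))
    (maximalIdeal 𝒪[K]) (maximalIdeal (integralClosure 𝒪[K] Ks))
    (FiniteField.frobeniusAlgEquivOfAlgebraic 𝓀[K] (ResField K Ks))
  refine ⟨g, RingEquiv.ext fun x => ?_⟩
  obtain ⟨a, rfl⟩ := residue_surjective x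
  exact DFunLike.congr_fun hg (residue _ a)

end SepClosure
end LocalWeil

/-! ### Elements of positive degree as Frobenius elements -/

namespace LocalWeil
open IsLocalRing

variable {K : Type*} [Field K] [ValuativeRel K] [TopologicalSpace K]
  [IsNonarchimedeanLocalField K] {Ks : Type*} [Field Ks] [Algebra K Ks] [IsSepClosure K Ks]

variable (K Ks) in
/-- The automorphisms fixing the integral roots of `X ^ N - X`. -/
noncomputable def rootFixer (N : ℕ) : Subgroup Gal(Ks/K) :=
  fixingSubgroup Gal(Ks/K) {a : integralClosure 𝒪[K] Ks | a ^ N = a}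

omit [TopologicalSpace K] [IsNonarchimedeanLocalField K] [IsSepClosure K Ks] in
theorem mem_rootFixer {N : ℕ} {g : Gal(Ks/K)} :
    g ∈ rootFixer K Ks N ↔ ∀ a : integralClosure 𝒪[K] Ks, a ^ N = a → g • a = a :=
  mem_fixingSubgroup_iff _

omit [TopologicalSpace K] [IsNonarchimedeanLocalField K] [IsSepClosure K Ks] in
theorem rootFixer_normal (N : ℕ) : (rootFixer K Ks N).Normal := by
  refine ⟨fun g hg h => mem_rootFixer.2 fun a ha => ?_⟩
  rw [mul_smul, mul_smul, mem_rootFixer.1 hg _ (by rw [← smul_pow', ha]), smul_inv_smul]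

theorem isOpen_rootFixer {N : ℕ} (hN : 1 < N) (h0 : (N : ResField K Ks) = 0) :
    IsOpen (rootFixer K Ks N : Set Gal(Ks/K)) := by
  have hfin : {a : integralClosure 𝒪[K] Ks | a ^ N = a}.Finite := by
    refine Set.finite_of_ncard_ne_zero ?_
    rw [ncard_integralClosure_setOf_pow_eq hN h0]
    omega
  have h := hfin.isOpen_biInter fun a _ => stabilizer_isOpen_of_isIntegral (K := K) (a : Ks)
  convert h
  ext g
  simp [mem_rootFixer, Subtype.ext_iff]

omit [TopologicalSpace K] [IsNonarchimedeanLocalField K] [IsSepClosure K Ks] in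
theorem rootFixer_pow_le (N m : ℕ) : rootFixer K Ks (N ^ m) ≤ rootFixer K Ks N := by
  intro g hg
  refine mem_rootFixer.2 fun a ha => mem_rootFixer.1 hg a ?_
  clear hg
  induction m with
  | zero => simp
  | succ m ih => rw [pow_succ', pow_mul, ha, ih]

theorem residueAction_apply_of_eq_pow {g : Gal(Ks/K)} {n : ℕ}
    (hg : residueAction K Ks g = residueFrobenius K Ks ^ n) (x : ResField K Ks) :
    residueAction K Ks g x = x ^ Nat.card 𝓀[K] ^ n := by
  rw [hg, residueFrobenius_pow_apply]

theorem one_lt_card_residueField : 1 < Nat.card 𝓀[K] := Finite.one_lt_card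

theorem mem_rootFixer_of_residueAction_eq_pow {g : Gal(Ks/K)} {n : ℕ} (hn : n ≠ 0)
    (hg : residueAction K Ks g = residueFrobenius K Ks ^ n) :
    g ∈ rootFixer K Ks (Nat.card 𝓀[K] ^ n) := by
  refine mem_rootFixer.2 fun a ha =>
    smul_eq_of_residueAction_eq (natCast_card_pow_eq_zero K Ks hn) ha ?_
  rw [residueAction_apply_of_eq_pow hg, ← map_pow, ha]

/-- If `g` acts as the `n`-th power of Frobenius, a power `g ^ c` with `c < m` fixing the elements
`x` of the residue field with `x ^ (q ^ (n * m)) = x` is trivial. -/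
theorem eq_zero_of_residueAction_pow_eq {g : Gal(Ks/K)} {n m c : ℕ} (hn : n ≠ 0)
    (hg : residueAction K Ks g = residueFrobenius K Ks ^ n) (hc : c < m)
    (h : ∀ x : ResField K Ks, x ^ Nat.card 𝓀[K] ^ (n * m) = x → residueAction K Ks (g ^ c) x = x) :
    c = 0 := by
  by_contra hc0
  have hgc : residueAction K Ks (g ^ c) = residueFrobenius K Ks ^ (n * c) := by
    rw [map_pow, hg, pow_mul]
  have hq := one_lt_card_residueField (K := K)
  have h1 {k : ℕ} (hk : k ≠ 0) := one_lt_pow₀ hq (mul_ne_zero hn hk)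
  have hm : m ≠ 0 := by omega
  have hsub : {x : ResField K Ks | x ^ Nat.card 𝓀[K] ^ (n * m) = x} ⊆
      {x | x ^ Nat.card 𝓀[K] ^ (n * c) = x} := fun x hx =>
    (residueAction_apply_of_eq_pow hgc x).symm.trans (h x hx)
  -- For c ≠ 0 this would put q^(nm) elements among the q^(nc) roots, although c < m.
  have hle := Set.ncard_le_ncard hsub (finite_setOf_pow_eq_and_ncard_le (h1 hc0)).1
  rw [ncard_resField_setOf_pow_eq (h1 hc0) (natCast_card_pow_eq_zero K Ks (mul_ne_zero hn hc0)),
    ncard_resField_setOf_pow_eq (h1 hm) (natCast_card_pow_eq_zero K Ks (mul_ne_zero hn hm))] at hle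
  rw [Nat.pow_le_pow_iff_right hq] at hle
  exact absurd (Nat.le_of_mul_le_mul_left hle (Nat.pos_of_ne_zero hn)) (by omega)

/-- An element of the Weil group of positive degree is a Frobenius element of a finite extension
of `K`, which can be chosen with small inertia group. -/
theorem exists_isFrobeniusOver (M : IntermediateField K Ks) [FiniteDimensional K M]
    (w : WeilGroup K Ks) {n : ℕ} (hn : n ≠ 0)
    (hw : residueAction K Ks (WeilGroup.toGal K Ks w) = residueFrobenius K Ks ^ n) :
    ∃ L : IntermediateField K Ks, FiniteDimensional K L ∧ IsFrobeniusOver w L ∧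
      inertiaGroup K Ks ⊓ L.fixingSubgroup ≤ M.fixingSubgroup := by
  have : IsGalois K Ks := inferInstance
  obtain ⟨g, hgw⟩ : ∃ g, WeilGroup.toGal K Ks w = g := ⟨_, rfl⟩
  unfold IsFrobeniusOver
  rw [hgw] at hw ⊢
  have hq := one_lt_card_residueField (K := K)
  obtain ⟨E, hE, hEn, hEM⟩ := (krullTopology_mem_nhds_one_iff_of_normal K Ks _).1
    (M.fixingSubgroup_isOpen.mem_nhds (one_mem _))
  have : IsGalois K E := ⟨⟩
  have hEo := E.fixingSubgroup_isOpen
  obtain ⟨m, hidx, hmE⟩ : ∃ m : ℕ, m ≠ 0 ∧ g ^ m ∈ E.fixingSubgroup := by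
    have := Subgroup.quotient_finite_of_isOpen _ hEo
    exact ⟨_, Subgroup.index_ne_zero_of_finite, Subgroup.pow_index_mem _ g⟩
  have hnm := mul_ne_zero hn hidx
  -- The first factor makes N' small enough for M. The second makes it act trivially on the residues
  -- with x^(q^(nm)) = x, so that inertia elements of ⟨g⟩N' can be recognised.
  let N' := E.fixingSubgroup ⊓ rootFixer K Ks (Nat.card 𝓀[K] ^ (n * m))
  have hNn : N'.Normal := by
    have := rootFixer_normal (K := K) (Ks := Ks) (Nat.card 𝓀[K] ^ (n * m))
    exact Subgroup.normal_inf_normal _ _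
  have hNo : IsOpen (N' : Set Gal(Ks/K)) :=
    hEo.inter (isOpen_rootFixer (one_lt_pow₀ hq hnm) (natCast_card_pow_eq_zero K Ks hnm))
  have hgm : g ^ m ∈ N' := by
    refine ⟨hmE, mem_rootFixer_of_residueAction_eq_pow hnm ?_⟩
    rw [map_pow, hw, pow_mul]
  let U := Subgroup.zpowers g ⊔ N'
  have hgU : g ∈ U := (le_sup_left : _ ≤ U) (Subgroup.mem_zpowers g)
  have hUo : IsOpen (U : Set Gal(Ks/K)) := Subgroup.isOpen_mono le_sup_right hNo
  let Uc : ClosedSubgroup Gal(Ks/K) := ⟨U, Subgroup.isClosed_of_isOpen _ hUo⟩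
  have hfix : (IntermediateField.fixedField U).fixingSubgroup = U :=
    InfiniteGalois.fixingSubgroup_fixedField Uc
  -- This puts the roots of X^(q^n) - X into the fixed field of U, whose residue field therefore has
  -- exactly q^n elements.
  have hUroot : U ≤ rootFixer K Ks (Nat.card 𝓀[K] ^ n) := by
    refine sup_le ?_ (inf_le_right.trans ?_)
    · rw [Subgroup.zpowers_le]
      exact mem_rootFixer_of_residueAction_eq_pow hn hw
    · rw [pow_mul]
      exact rootFixer_pow_le _ _
  refine ⟨IntermediateField.fixedField U, ?_, ⟨hfix.ge hgU, fun x => ?_⟩, ?_⟩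
  · refine (InfiniteGalois.isOpen_iff_finite _).1 ?_
    rw [hfix]
    exact hUo
  · rw [residueAction_apply_of_eq_pow hw, card_resField_eq (one_lt_pow₀ hq hn)
      (natCast_card_pow_eq_zero K Ks hn) _ (hfix.ge hgU) (residueAction_apply_of_eq_pow hw)]
    intro a ha
    rw [IntermediateField.mem_fixedField_iff]
    intro f hf
    exact congrArg Subtype.val (mem_rootFixer.1 (hUroot hf) a ha)
  · rw [hfix]
    rintro u ⟨hui, huU⟩
    obtain ⟨y, hy, ν, hν, rfl⟩ := Subgroup.mem_sup_of_normal_right.1 huU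
    obtain ⟨j, rfl⟩ := Subgroup.mem_zpowers_iff.1 hy
    have hm0 : (0 : ℤ) < m := by omega
    obtain ⟨c, hc⟩ := Int.eq_ofNat_of_zero_le (Int.emod_nonneg j hm0.ne')
    have hcm : c < m := by have := Int.emod_lt_of_pos j hm0; omega
    -- Since g^m lies in N', every element of U is g^c ν' with 0 ≤ c < m and ν' in N'. If it is
    -- inertial, g^c acts trivially on the residues fixed by ν', forcing c = 0.
    have hj : g ^ j = g ^ c * (g ^ m) ^ (j / m) := by
      rw [← zpow_natCast, ← zpow_natCast, ← zpow_mul, ← zpow_add, ← hc, Int.emod_add_mul_ediv]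
    have hν' : (g ^ m) ^ (j / m) * ν ∈ N' := mul_mem (zpow_mem hgm _) hν
    rw [hj, mul_assoc] at hui ⊢
    set ν' := (g ^ m) ^ (j / m) * ν
    have hc0 : c = 0 := by
      refine eq_zero_of_residueAction_pow_eq hn hw hcm fun x hx => ?_
      obtain ⟨a, ha, rfl⟩ := exists_residue_eq_of_pow_eq (one_lt_pow₀ hq hnm)
        (natCast_card_pow_eq_zero K Ks hnm) hx
      have h1 : residueAction K Ks ν' (residue _ a) = residue _ a := by
        rw [residueAction_residue, mem_rootFixer.1 hν'.2 a ha]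
      have h2 : residueAction K Ks (g ^ c * ν') = 1 := hui
      have h3 := DFunLike.congr_fun h2 (residue _ a)
      rwa [map_mul, RingAut.mul_apply, h1] at h3
    rw [hc0, pow_zero, one_mul]
    exact hEM hν'.1

theorem IsUnramifiedOver.of_le {V : Type*} [AddCommGroup V] [Module ℂ V]
    {ρ : Representation ℂ (WeilGroup K Ks) V} {M L : IntermediateField K Ks}
    (h : IsUnramifiedOver ρ M)
    (hL : inertiaGroup K Ks ⊓ L.fixingSubgroup ≤ M.fixingSubgroup) : IsUnramifiedOver ρ L :=
  fun w hw => h w ⟨hw.1, hL hw⟩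

end LocalWeil

/-! ### Conclusion -/

open LocalWeil in
theorem corollary4 (K : Type*) [Field K] [ValuativeRel K] [TopologicalSpace K]
    [IsNonarchimedeanLocalField K] (Ks : Type*) [Field Ks] [Algebra K Ks] [IsSepClosure K Ks]
    {V₁ V₂ : Type*} [AddCommGroup V₁] [Module ℂ V₁] [AddCommGroup V₂] [Module ℂ V₂]
    (ρ₁ : Representation ℂ (WeilGroup K Ks) V₁) (ρ₂ : Representation ℂ (WeilGroup K Ks) V₂)
    (hρ₁ : IsWeilRepresentation ρ₁) (hρ₂ : IsWeilRepresentation ρ₂)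
    (hs₁ : ρ₁.IsSemisimpleRepresentation) (hs₂ : ρ₂.IsSemisimpleRepresentation)
    (htr : ∀ L : IntermediateField K Ks, FiniteDimensional K L →
      IsUnramifiedOver ρ₁ L → IsUnramifiedOver ρ₂ L →
      ∀ w : WeilGroup K Ks, IsFrobeniusOver w L →
        LinearMap.trace ℂ V₁ (ρ₁ w) = LinearMap.trace ℂ V₂ (ρ₂ w)) :
    Nonempty (ρ₁.Equiv ρ₂) := by
  have := hρ₁.finiteDimensional
  have := hρ₂.finiteDimensional
  obtain ⟨M₁, hM₁, hu₁⟩ := hρ₁.exists_finiteDimensional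
  obtain ⟨M₂, hM₂, hu₂⟩ := hρ₂.exists_finiteDimensional
  have hpos : ∀ (w : WeilGroup K Ks) (n : ℕ), n ≠ 0 →
      residueAction K Ks (WeilGroup.toGal K Ks w) = residueFrobenius K Ks ^ n →
      LinearMap.trace ℂ V₁ (ρ₁ w) = LinearMap.trace ℂ V₂ (ρ₂ w) := by
    intro w n hn hw
    -- The compositum makes I_L small enough for both representations at once.
    obtain ⟨L, hL, hwL, hLM⟩ := exists_isFrobeniusOver (M₁ ⊔ M₂) w hn hw
    exact htr L hL
      (hu₁.of_le (hLM.trans (IntermediateField.fixingSubgroup_antitone le_sup_left)))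
      (hu₂.of_le (hLM.trans (IntermediateField.fixingSubgroup_antitone le_sup_right))) w hwL
  obtain ⟨φ₀, hφ₀⟩ := exists_residueAction_eq_residueFrobenius (K := K) (Ks := Ks)
  let φ : WeilGroup K Ks := ⟨φ₀, 1, by simp [hφ₀]⟩
  have hφ : residueAction K Ks (WeilGroup.toGal K Ks φ) = residueFrobenius K Ks := hφ₀
  refine ρ₁.nonempty_equiv_of_trace_eq ρ₂ hs₁ hs₂ fun w => ?_
  obtain ⟨d, hd⟩ : ∃ d : ℤ, residueFrobenius K Ks ^ d =
    residueAction K Ks (WeilGroup.toGal K Ks w) := w.2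
  -- This N makes the degree d + N(k + 1) of w φ^(N(k+1)) positive for every k ≥ 0.
  obtain ⟨N, hN⟩ : ∃ N : ℕ, 0 < d + N := ⟨d.natAbs + 1, by omega⟩
  refine LinearMap.trace_eq_of_forall_mul_pow (A' := ρ₁ (φ ^ N)) (B' := ρ₂ (φ ^ N))
    ((Group.isUnit _).map ρ₁) ((Group.isUnit _).map ρ₂) fun k => ?_
  rw [← map_pow, ← map_pow, ← map_mul, ← map_mul]
  have hdeg : 0 < d + (N * (k + 1) : ℕ) := by
    push_cast
    have : (0 : ℤ) ≤ N * k := by positivity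
    linarith
  refine hpos _ (d + (N * (k + 1) : ℕ)).toNat (by omega) ?_
  rw [← zpow_natCast (residueFrobenius K Ks), Int.toNat_of_nonneg hdeg.le, zpow_add, zpow_natCast,
    pow_mul, hd, ← hφ]
  simp only [map_mul, map_pow]
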